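/- Let $T$ be the $4$-adic rooted tree, with vertices the finite words over the alphabet $X=\{1,2,3,4\}$ (words of length $n$ form the $n$th level, and each vertex $w$ is joined to its children $wx$, $x\in X$). Let $a\in\mathrm{Aut}(T)$ be the rooted automorphism $xw\mapsto x^{(1\,2\,3\,4)}w$ that cyclically permutes the four subtrees hanging from the root, and let $b\in\mathrm{Aut}(T)$ be the automorphism that fixes every vertex of the first level and is defined recursively by acting on the four subtrees rooted at the vertices $1,2,3,4$ as $a,\,1,\,a,\,b$, respectively. The group $\mathcal{G}=\langle a,b\rangle\le\mathrm{Aut}(T)$ is the second Grigorchuk group. For $H\le\mathrm{Aut}(T)$ let $\mathrm{St}_H(n)$ be the subgroup of all elements of $H$ that fix every vertex of level $n$; give $\mathrm{Aut}(T)$ the topology in which the subgroups $\mathrm{St}_{\mathrm{Aut}(T)}(n)$ form a basis of neighbourhoods of the identity. Let $\Gamma=\varprojlim_n C_4\wr\overset{n}{\cdots}\wr C_4\le\mathrm{Aut}(T)$ be the group of all $4$-adic automorphisms, i.e. those whose local permutation of $X$ at every vertex is a power of $(1\,2\,3\,4)$; it is closed and contains $\mathcal{G}$. For a closed subgroup $H\le\Gamma$,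 its Hausdorff dimension in $\Gamma$ is \[ \mathrm{hdim}_\Gamma(H)=\liminf_{n\to\infty}\frac{\log|H:\mathrm{St}_H(n)|}{\log|\Gamma:\mathrm{St}_\Gamma(n)|}. \] Then (i) the logarithmic orders of the congruence quotients of $\mathcal{G}$ are \[ \log_4|\mathcal{G}:\mathrm{St}_{\mathcal{G}}(n)|= \begin{cases} 1 & \text{if } n=1,\\ 3 & \text{if } n=2,\\ \frac13\left(86\cdot 4^{n-4}+4\right) & \text{if } n>2; \end{cases} \] (ii) the Hausdorff dimension in $\Gamma$ of the closure $\overline{\mathcal{G}}$ of $\mathcal{G}$ is $\mathrm{hdim}_\Gamma(\overline{\mathcal{G}})=43/128$. -/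

import Mathlib

open Filter Topology

noncomputable section

namespace Grigorchuk

/-- Vertices of the `4`-adic rooted tree: finite words over the alphabet `{0, 1, 2, 3}`. The root is the empty word, and the length of a word is its level. -/
abbrev Word : Type := List (Fin 4)

/-- The group of automorphisms of the `4`-adic rooted tree: bijections of the vertices which
preserve and reflect the relation that one vertex precedes another one (is a prefix of it). -/
abbrev TreeAut : Type := ((· <+: ·) : Word → Word → Prop) ≃r ((· <+: ·) : Word → Word → Prop)

theorem length_le_length_apply (f : TreeAut) (w : Word) : w.length ≤ (f w).length := by
  induction w using List.reverseRecOn with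
  | nil => simp
  | append_singleton w x ih =>
    have h : f w <+: f (w ++ [x]) := f.map_rel_iff.2 (List.prefix_append _ _)
    have h1 := h.length_le
    have h2 : (f w).length ≠ (f (w ++ [x])).length := by
      intro e
      have := f.injective (h.eq_of_length e)
      simp at this
    simp only [List.length_append, List.length_singleton]
    omega

theorem length_apply (f : TreeAut) (w : Word) : (f w).length = w.length := by
  apply le_antisymm _ (length_le_length_apply f w)
  have h := length_le_length_apply f⁻¹ (f w)
  rwa [RelIso.inv_apply_self] at h

/-- The `n`th level stabiliser of the full automorphism group: all automorphisms which fix every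
vertex of level `n`. -/
def levelStab (n : ℕ) : Subgroup TreeAut where
  carrier := {f | ∀ w : Word, w.length = n → f w = w}
  one_mem' := fun _ _ => rfl
  mul_mem' := by
    intro f g hf hg w hw
    rw [RelIso.mul_apply, hg w hw, hf w hw]
  inv_mem' := by
    intro f hf w hw
    have h := congrArg (f⁻¹ : TreeAut) (hf w hw)
    rw [RelIso.inv_apply_self] at h
    exact h.symm

theorem mem_levelStab {n : ℕ} {f : TreeAut} :
    f ∈ levelStab n ↔ ∀ w : Word, w.length = n → f w = w := Iff.rfl

instance levelStab_normal (n : ℕ) : (levelStab n).Normal where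
  conj_mem := by
    intro f hf g w hw
    rw [RelIso.mul_apply, RelIso.mul_apply, hf _ (by rw [length_apply, hw]),
      RelIso.apply_inv_self]

theorem levelStab_antitone : Antitone levelStab := by
  intro m n hmn f hf w hw
  have h : f w <+: f (w ++ List.replicate (n - m) 0) := f.map_rel_iff.2 (List.prefix_append _ _)
  rw [hf (w ++ List.replicate (n - m) 0)
    (by simp only [List.length_append, List.length_replicate, hw]; omega)] at h
  exact (List.prefix_of_prefix_length_le h (List.prefix_append w (List.replicate (n - m) 0))
    (length_apply f w).le).eq_of_length (length_apply f w)

/-- The level stabilisers as a basis of neighbourhoods of the identity. -/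
abbrev levelBasis : GroupFilterBasis TreeAut where
  sets := Set.range fun n => (levelStab n : Set TreeAut)
  nonempty := Set.range_nonempty _
  inter_sets := by
    rintro _ _ ⟨m, rfl⟩ ⟨n, rfl⟩
    exact ⟨_, ⟨max m n, rfl⟩, Set.subset_inter
      (levelStab_antitone (le_max_left m n)) (levelStab_antitone (le_max_right m n))⟩
  one' := by
    rintro _ ⟨n, rfl⟩
    exact (levelStab n).one_mem
  mul' := by
    rintro _ ⟨n, rfl⟩
    refine ⟨_, ⟨n, rfl⟩, ?_⟩
    rintro _ ⟨f, hf, g, hg, rfl⟩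
    exact (levelStab n).mul_mem hf hg
  inv' := by
    rintro _ ⟨n, rfl⟩
    exact ⟨_, ⟨n, rfl⟩, fun f hf => (levelStab n).inv_mem hf⟩
  conj' := by
    rintro g _ ⟨n, rfl⟩
    exact ⟨_, ⟨n, rfl⟩, fun f hf => (levelStab_normal n).conj_mem f hf g⟩

/-- The profinite (congruence) topology on the automorphism group of the tree. -/
instance : TopologicalSpace TreeAut := levelBasis.topology

instance : IsTopologicalGroup TreeAut := levelBasis.isTopologicalGroup

/-- The group `Γ` of all `4`-adic automorphisms: the automorphisms whose label at every vertex is a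
power of the cycle `(0 1 2 3)`, that is, the inverse limit of the iterated wreath products
`C₄ ≀ ⋯ ≀ C₄` acting on the levels of the tree. -/
def Gamma : Subgroup TreeAut where
  carrier := {f | ∀ w : Word, ∃ σ ∈ Subgroup.zpowers (finRotate 4),
    ∀ x : Fin 4, f (w ++ [x]) = f w ++ [σ x]}
  one_mem' := fun _ => ⟨1, one_mem _, fun _ => rfl⟩
  mul_mem' := by
    intro f g hf hg w
    obtain ⟨σ, hσ, h⟩ := hg w
    obtain ⟨τ, hτ, h'⟩ := hf (g w)
    refine ⟨τ * σ, mul_mem hτ hσ, fun x => ?_⟩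
    rw [RelIso.mul_apply, RelIso.mul_apply, h, h', Equiv.Perm.mul_apply]
  inv_mem' := by
    intro f hf w
    obtain ⟨σ, hσ, h⟩ := hf (f⁻¹ w)
    refine ⟨σ⁻¹, inv_mem hσ, fun x => ?_⟩
    have h2 := congrArg (f⁻¹ : TreeAut) (h (σ⁻¹ x))
    rw [RelIso.inv_apply_self, RelIso.apply_inv_self, ← Equiv.Perm.mul_apply, mul_inv_cancel,
      Equiv.Perm.one_apply] at h2
    exact h2.symm

/-- For a subgroup `H` of the automorphism group of the tree, the index of the `n`th level
stabiliser of `H` in `H`, i.e. the order of the `n`th congruence quotient of `H`. -/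
def congruenceIndex (H : Subgroup TreeAut) (n : ℕ) : ℕ :=
  ((levelStab n).subgroupOf H).index

/-- The Hausdorff dimension of a closed subgroup `H` of `Γ`, i.e. the lower limit of
`log |H : St_H(n)| / log |Γ : St_Γ(n)|` as `n → ∞`. -/
def hausdorffDim (H : Subgroup TreeAut) : ℝ :=
  liminf (fun n : ℕ => Real.log (congruenceIndex H n) / Real.log (congruenceIndex Gamma n)) atTop

/-- The action on words of the rooted automorphism `a`, which corresponds to `(0 1 2 3)`. -/
def aFun : Word → Word
  | [] => []
  | x :: w => finRotate 4 x :: w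

/-- The action on words of the inverse of `a`. -/
def aInvFun : Word → Word
  | [] => []
  | x :: w => (finRotate 4).symm x :: w

/-- The action on words of the automorphism `b = (a, 1, a, b)`. -/
def bFun : Word → Word
  | [] => []
  | 0 :: w => 0 :: aFun w
  | 1 :: w => 1 :: w
  | 2 :: w => 2 :: aFun w
  | 3 :: w => 3 :: bFun w

/-- The action on words of the inverse `(a⁻¹, 1, a⁻¹, b⁻¹)` of `b`. -/
def bInvFun : Word → Word
  | [] => []
  | 0 :: w => 0 :: aInvFun w
  | 1 :: w => 1 :: w
  | 2 :: w => 2 :: aInvFun w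
  | 3 :: w => 3 :: bInvFun w

theorem aFun_prefix_iff (u v : Word) : aFun u <+: aFun v ↔ u <+: v := by
  cases u <;> cases v <;> simp [aFun, List.cons_prefix_cons]

theorem bFun_prefix_iff (u v : Word) : bFun u <+: bFun v ↔ u <+: v := by
  induction u generalizing v with
  | nil => simp [bFun]
  | cons x u ih =>
    cases v with
    | nil => fin_cases x <;> simp [bFun]
    | cons y v =>
      fin_cases x <;> fin_cases y <;>
        simp [bFun, List.cons_prefix_cons, aFun_prefix_iff, ih]

theorem aInvFun_aFun (w : Word) : aInvFun (aFun w) = w := by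
  cases w <;> simp [aFun, aInvFun]

theorem aFun_aInvFun (w : Word) : aFun (aInvFun w) = w := by
  cases w <;> simp [aFun, aInvFun]

theorem bInvFun_bFun (w : Word) : bInvFun (bFun w) = w := by
  induction w with
  | nil => rfl
  | cons x w ih => fin_cases x <;> simp [bFun, bInvFun, aInvFun_aFun, ih]

theorem bFun_bInvFun (w : Word) : bFun (bInvFun w) = w := by
  induction w with
  | nil => rfl
  | cons x w ih => fin_cases x <;> simp [bFun, bInvFun, aFun_aInvFun, ih]

/-- The generator `a`: the rooted automorphism corresponding to the cycle `(0 1 2 3)`. -/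
def genA : TreeAut where
  toFun := aFun
  invFun := aInvFun
  left_inv := aInvFun_aFun
  right_inv := aFun_aInvFun
  map_rel_iff' := aFun_prefix_iff _ _

/-- The generator `b`: it fixes the first level and acts on the four subtrees rooted there as
`(a, 1, a, b)`. -/
def genB : TreeAut where
  toFun := bFun
  invFun := bInvFun
  left_inv := bInvFun_bFun
  right_inv := bFun_bInvFun
  map_rel_iff' := bFun_prefix_iff _ _

/-- The second Grigorchuk group. -/
def secondGrigorchuk : Subgroup TreeAut := Subgroup.closure {genA, genB}

theorem aFun_append (w : Word) : ∃ σ ∈ Subgroup.zpowers (finRotate 4),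
    ∀ x : Fin 4, aFun (w ++ [x]) = aFun w ++ [σ x] := by
  cases w with
  | nil => exact ⟨_, Subgroup.mem_zpowers _, fun x => rfl⟩
  | cons y w => exact ⟨1, one_mem _, fun x => rfl⟩

theorem bFun_append (w : Word) : ∃ σ ∈ Subgroup.zpowers (finRotate 4),
    ∀ x : Fin 4, bFun (w ++ [x]) = bFun w ++ [σ x] := by
  induction w with
  | nil => exact ⟨1, one_mem _, fun x => by fin_cases x <;> rfl⟩
  | cons y w ih =>
    obtain ⟨σ, hσ, h⟩ := ih
    obtain ⟨τ, hτ, h'⟩ := aFun_append w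
    fin_cases y
    · exact ⟨τ, hτ, fun x => by simp [bFun, h']⟩
    · exact ⟨1, one_mem _, fun x => rfl⟩
    · exact ⟨τ, hτ, fun x => by simp [bFun, h']⟩
    · exact ⟨σ, hσ, fun x => by simp [bFun, h]⟩

theorem secondGrigorchuk_le_Gamma : secondGrigorchuk ≤ Gamma := by
  refine (Subgroup.closure_le _).2 ?_
  rintro f (rfl | rfl)
  · exact aFun_append
  · exact bFun_append

/-- `Γ` is closed, so that the closure of a subgroup of `Γ` in `Γ` is its closure in the full
automorphism group of the tree. -/
theorem isClosed_Gamma : IsClosed (Gamma : Set TreeAut) := by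
  rw [← isOpen_compl_iff, isOpen_iff_mem_nhds]
  intro f hf
  rw [levelBasis.nhds_hasBasis f |>.mem_iff]
  by_contra hcon
  apply hf
  intro w
  have hstab : (levelStab (w.length + 1) : Set TreeAut) ∈ levelBasis := ⟨_, rfl⟩
  have : ∃ g ∈ levelStab (w.length + 1), f * g ∈ Gamma := by
    by_contra h
    push Not at h
    refine hcon ⟨_, hstab, ?_⟩
    rintro _ ⟨g, hg, rfl⟩
    exact h g hg
  obtain ⟨g, hg, hfg⟩ := this
  obtain ⟨σ, hσ, h⟩ := hfg w
  refine ⟨σ, hσ, fun x => ?_⟩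
  have h1 := h x
  rwa [RelIso.mul_apply, RelIso.mul_apply, hg _ (by simp),
    levelStab_antitone (Nat.le_succ _) hg w rfl] at h1

theorem topologicalClosure_le_Gamma : secondGrigorchuk.topologicalClosure ≤ Gamma :=
  Subgroup.topologicalClosure_minimal _ secondGrigorchuk_le_Gamma isClosed_Gamma

end Grigorchuk

end

/-!
The order of the `(n+1)`st congruence quotient of `𝒢 = ⟨a, b⟩` is four times the order of the image
of `St(1)` in the direct power of the `n`th congruence quotient, so the point is to describe the
image `D` of `St(1)` in `𝒢⁴` under taking sections.

The group `𝒢` maps onto the Heisenberg group over `ℤ/4`, with coordinates `(α, β, κ)`: the exponent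
sum `α` of `a` is the label at the root, the exponent sum `β` of `b` is the sum of two labels on the
first level, and `κ` is a weighted sum of the numbers `β` of the four sections. In particular `α`,
`β`, `κ` are trivial on `St(1)`, `St(2)`, `St(3)`, respectively. The kernel of this map is `γ₃(𝒢)`,
and `𝒢` branches over it: conjugating `(c, 1, 1, c⁻¹)`, where `c = b⁻¹a⁻¹ba`, with the rotations of
`(a, 1, a, b)` shows that `D` contains the copy of `γ₃(𝒢)` in each coordinate
(`IsBranching.mem_branchingKernel_of_eq_zero`).

Therefore `D` is determined by its coordinates, and it turns out to be given by the linear relations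
`α(g x) = β(g (x+1)) + β(g (x-1))` and the quadratic relation
`∑ x, κ(g x) = ∑ x, β(g x) β(g (x+1))`. These are preserved under multiplication because the cocycle
of the Heisenberg group, summed over the coordinates, is on tuples satisfying the linear relation
the polarisation of the quadratic form on the right (`sum_add_mul_add`). The linear relations have
index `4⁴` and the quadratic one has a further index `4`. For `n ≥ 3` the group `St(n)⁴` is
contained in `D`, so `|𝒢 : St(n+1)| = 4 |𝒢 : St(n)|⁴ / 4⁵`. For `n = 2` the central coordinate of an
element of `St(2)` may be `2`, so that only twice the quadratic relation holds on `D St(2)⁴`, and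
the index `4⁵` is replaced by `4⁴ * 2` (`IsBranching.sup_pi_eq`, `HeisenbergCoords.index_relations`). With
`|𝒢 : St(2)| = 4³`, found directly, this gives `2 ^ 17` for `n = 3` and then all further orders.

For `Γ` the image of `St(1)` is all of `Γ⁴`. Passing to the closure does not change congruence
quotients, so the Hausdorff dimension is an honest limit.
-/

open scoped Fin.CommRing

/-! ### Branching over the kernel of a map onto the Heisenberg group -/

theorem four_eq_zero : (4 : Fin 4) = 0 := rfl

/-- Coordinates `(α, β, κ)` on a group generated by `a` and `b` which describe a homomorphism onto
the Heisenberg group over `ℤ/4`. The ring `ℤ/4` is encoded as `Fin 4`, the alphabet of the tree,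
so that letters and exponents may be added. -/
structure HeisenbergCoords (G : Type*) [Group G] (a b : G) where
  /-- The exponent sum of `a`. -/
  α : G → Fin 4
  /-- The exponent sum of `b`. -/
  β : G → Fin 4
  /-- The central coordinate. -/
  κ : G → Fin 4
  α_mul : ∀ g h, α (g * h) = α g + α h
  β_mul : ∀ g h, β (g * h) = β g + β h
  κ_mul : ∀ g h, κ (g * h) = κ g + κ h + β g * α h
  α_a : α a = 1
  β_a : β a = 0
  κ_a : κ a = 0
  α_b : α b = 0
  β_b : β b = 1
  κ_b : κ b = 0
  closure_eq : Subgroup.closure {a, b} = ⊤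
  a_pow : a ^ 4 = 1
  b_pow : b ^ 4 = 1

theorem sum_add_right {M : Type*} [AddCommMonoid M] (u : Fin 4 → M) (t : Fin 4) :
    ∑ x, u (x + t) = ∑ x, u x := Equiv.sum_comp (Equiv.addRight t) u

/-- The polarisation of the quadratic form `∑ x, u x * u (x + 1)`. -/
theorem sum_add_mul_add (u v : Fin 4 → Fin 4) :
    ∑ x, (u x + v x) * (u (x + 1) + v (x + 1)) = ∑ x, u x * u (x + 1) + ∑ x, v x * v (x + 1) +
      ∑ x, u x * (v (x + 1) + v (x - 1)) := by
  have h := sum_add_right (fun x => u x * v (x - 1)) 1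
  simp only [add_sub_cancel_right, mul_comm (u _) (v _)] at h
  simp only [mul_add, add_mul, Finset.sum_add_distrib]
  rw [h]
  simp only [mul_comm (u _) (v _)]
  ring

theorem sum_mul_add_neighbours (u : Fin 4 → Fin 4) :
    ∑ x, u x * (u (x + 1) + u (x - 1)) = 2 * ∑ x, u x * u (x + 1) := by
  have h := sum_add_right (fun x => u x * u (x - 1)) 1
  simp only [add_sub_cancel_right] at h
  simp only [mul_add, Finset.sum_add_distrib, ← h, mul_comm (u (_ + 1))]
  ring

namespace HeisenbergCoords

variable {G : Type*} [Group G] {a b : G} (C : HeisenbergCoords G a b)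

@[simp] theorem α_one : C.α 1 = 0 := by
  simpa using C.α_mul 1 1

@[simp] theorem β_one : C.β 1 = 0 := by
  simpa using C.β_mul 1 1

@[simp] theorem κ_one : C.κ 1 = 0 := by
  simpa using C.κ_mul 1 1

@[simp] theorem α_inv (g : G) : C.α g⁻¹ = -C.α g := by
  have h := C.α_mul g g⁻¹
  rw [mul_inv_cancel, C.α_one] at h
  linear_combination -h

@[simp] theorem β_inv (g : G) : C.β g⁻¹ = -C.β g := by
  have h := C.β_mul g g⁻¹
  rw [mul_inv_cancel, C.β_one] at h
  linear_combination -h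

theorem κ_inv (g : G) : C.κ g⁻¹ = -C.κ g + C.β g * C.α g := by
  have h := C.κ_mul g g⁻¹
  rw [mul_inv_cancel, C.κ_one, C.α_inv] at h
  linear_combination -h

theorem α_pow (g : G) (n : ℕ) : C.α (g ^ n) = n * C.α g := by
  induction n with
  | zero => simp
  | succ n ih => rw [pow_succ, C.α_mul, ih]; push_cast; ring

theorem β_pow (g : G) (n : ℕ) : C.β (g ^ n) = n * C.β g := by
  induction n with
  | zero => simp
  | succ n ih => rw [pow_succ, C.β_mul, ih]; push_cast; ring

theorem κ_pow {g : G} (hg : C.α g = 0) (n : ℕ) : C.κ (g ^ n) = n * C.κ g := by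
  induction n with
  | zero => simp
  | succ n ih => rw [pow_succ, C.κ_mul, ih, hg]; push_cast; ring

@[simp] theorem α_comm : C.α (b⁻¹ * a⁻¹ * b * a) = 0 := by
  simp [C.α_mul, C.α_a, C.α_b]

@[simp] theorem β_comm : C.β (b⁻¹ * a⁻¹ * b * a) = 0 := by
  simp [C.β_mul, C.β_a, C.β_b]

@[simp] theorem κ_comm : C.κ (b⁻¹ * a⁻¹ * b * a) = 1 := by
  simp [C.κ_mul, C.β_mul, C.κ_inv, C.α_a, C.α_b, C.β_a, C.β_b, C.κ_a, C.κ_b]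

theorem pow_fin_add {H : Type*} [Group H] {x : H} (hx : x ^ 4 = 1) (u v : Fin 4) :
    x ^ (u + v).val = x ^ u.val * x ^ v.val := by
  rw [Fin.val_add, ← pow_add, ← pow_eq_pow_mod _ hx]

/-- Modulo a normal subgroup over which the commutator of `a` and `b` is central, every element is
determined by its Heisenberg coordinates. -/
theorem mk_eq (K : Subgroup G) [K.Normal]
    (ha : (b⁻¹ * a⁻¹ * b * a)⁻¹ * a⁻¹ * (b⁻¹ * a⁻¹ * b * a) * a ∈ K)
    (hb : (b⁻¹ * a⁻¹ * b * a)⁻¹ * b⁻¹ * (b⁻¹ * a⁻¹ * b * a) * b ∈ K) (g : G) :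
    (g : G ⧸ K) = (a : G ⧸ K) ^ (C.α g).val * (b : G ⧸ K) ^ (C.β g).val *
      ((b⁻¹ * a⁻¹ * b * a : G) : G ⧸ K) ^ (C.κ g).val := by
  set A : G ⧸ K := (a : G ⧸ K) with hA
  set B : G ⧸ K := (b : G ⧸ K) with hB
  set c : G := b⁻¹ * a⁻¹ * b * a with hc
  have hA4 : A ^ 4 = 1 := by rw [hA, ← QuotientGroup.mk_pow, C.a_pow]; rfl
  have hB4 : B ^ 4 = 1 := by rw [hB, ← QuotientGroup.mk_pow, C.b_pow]; rfl
  have hcA : Commute (c : G ⧸ K) A := by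
    have := QuotientGroup.eq.2 (show (a * c)⁻¹ * (c * a) ∈ K by convert ha using 1; group)
    exact this.symm
  have hcB : Commute (c : G ⧸ K) B := by
    have := QuotientGroup.eq.2 (show (b * c)⁻¹ * (c * b) ∈ K by convert hb using 1; group)
    exact this.symm
  have hBA : B * A = A * B * (c : G ⧸ K) := by
    rw [hA, hB, ← QuotientGroup.mk_mul, ← QuotientGroup.mk_mul, ← QuotientGroup.mk_mul]
    congr 1
    rw [hc]; group
  have hBA' : ∀ n : ℕ, B ^ n * A = A * B ^ n * (c : G ⧸ K) ^ n := by
    intro n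
    induction n with
    | zero => simp
    | succ n ih =>
      calc B ^ (n + 1) * A = B ^ n * (B * A) := by rw [pow_succ]; group
        _ = B ^ n * A * (B * c) := by rw [hBA]; group
        _ = A * B ^ n * ((c : G ⧸ K) ^ n * B) * c := by rw [ih]; group
        _ = A * B ^ n * (B * (c : G ⧸ K) ^ n) * c := by rw [(hcB.pow_left n).eq]
        _ = _ := by rw [pow_succ, pow_succ]; group
  have hc4 : (c : G ⧸ K) ^ 4 = 1 := by
    have h := hBA' 4
    rw [hB4, one_mul, mul_one] at h
    exact (mul_eq_left.1 h.symm)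
  have stepa : ∀ x : G, (x : G ⧸ K) = A ^ (C.α x).val * B ^ (C.β x).val *
      (c : G ⧸ K) ^ (C.κ x).val → ((x * a : G) : G ⧸ K) = A ^ (C.α (x * a)).val *
      B ^ (C.β (x * a)).val * (c : G ⧸ K) ^ (C.κ (x * a)).val := by
    intro x hx
    rw [QuotientGroup.mk_mul, hx, C.α_mul, C.β_mul, C.κ_mul, C.α_a, C.β_a, C.κ_a, add_zero,
      add_zero, mul_one, pow_fin_add hA4, pow_fin_add hc4, ← hA, mul_assoc,
      (hcA.pow_left _).eq, ← mul_assoc, mul_assoc (A ^ (C.α x).val), hBA',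
      show ((1 : Fin 4) : ℕ) = 1 from rfl, pow_one, (Commute.pow_pow_self (c : G ⧸ K) _ _).eq]
    simp only [mul_assoc]
  have stepb : ∀ x : G, (x : G ⧸ K) = A ^ (C.α x).val * B ^ (C.β x).val *
      (c : G ⧸ K) ^ (C.κ x).val → ((x * b : G) : G ⧸ K) = A ^ (C.α (x * b)).val *
      B ^ (C.β (x * b)).val * (c : G ⧸ K) ^ (C.κ (x * b)).val := by
    intro x hx
    rw [QuotientGroup.mk_mul, hx, C.α_mul, C.β_mul, C.κ_mul, C.α_b, C.β_b, C.κ_b, add_zero,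
      add_zero, mul_zero, add_zero, pow_fin_add hB4, ← hB, mul_assoc, (hcB.pow_left _).eq,
      show ((1 : Fin 4) : ℕ) = 1 from rfl, pow_one]
    simp only [mul_assoc]
  have hg : g ∈ Subgroup.closure {a, b} := by rw [C.closure_eq]; trivial
  induction hg using Subgroup.closure_induction_right with
  | one => simp
  | mul_right x _ y hy ih =>
    rcases hy with rfl | rfl
    · exact stepa x ih
    · exact stepb x ih
  | mul_inv_cancel x _ y hy ih =>
    rcases hy with rfl | rfl
    · have h : x * y⁻¹ = x * y * y * y := by
        rw [mul_assoc, mul_assoc, mul_right_inj, inv_eq_iff_mul_eq_one]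
        simpa [pow_succ, mul_assoc] using C.a_pow
      rw [h]
      exact stepa _ (stepa _ (stepa _ ih))
    · have h : x * y⁻¹ = x * y * y * y := by
        rw [mul_assoc, mul_assoc, mul_right_inj, inv_eq_iff_mul_eq_one]
        simpa [pow_succ, mul_assoc] using C.b_pow
      rw [h]
      exact stepb _ (stepb _ (stepb _ ih))

/-- The properties of the image of the first level stabiliser in the direct power of the group
which determine that image: it is invariant under rotation of the coordinates, contains
`(a, 1, a, b)`, and satisfies a linear and a quadratic relation in the Heisenberg coordinates. -/
structure IsBranching (D : Subgroup (Fin 4 → G)) : Prop where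
  rot : ∀ d ∈ D, (fun x => d (x + 1)) ∈ D
  gen : ![a, 1, a, b] ∈ D
  linear : ∀ d ∈ D, ∀ x, C.α (d x) = C.β (d (x + 1)) + C.β (d (x - 1))
  quadratic : ∀ d ∈ D, ∑ x, C.κ (d x) = ∑ x, C.β (d x) * C.β (d (x + 1))

/-- The homomorphism whose kernel consists of the tuples which satisfy the linear relation. -/
def linearDefect : (Fin 4 → G) →* Multiplicative (Fin 4 → Fin 4) where
  toFun g := Multiplicative.ofAdd fun x => C.α (g x) - C.β (g (x + 1)) - C.β (g (x - 1))
  map_one' := by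
    rw [← ofAdd_zero]
    congr 1
    funext x
    simp
  map_mul' g h := by
    rw [← ofAdd_add]
    congr 1
    funext x
    simp only [Pi.mul_apply, Pi.add_apply, C.α_mul, C.β_mul]
    ring

theorem mem_ker_linearDefect {g : Fin 4 → G} :
    g ∈ C.linearDefect.ker ↔ ∀ x, C.α (g x) = C.β (g (x + 1)) + C.β (g (x - 1)) := by
  rw [MonoidHom.mem_ker, linearDefect]
  change Multiplicative.ofAdd _ = Multiplicative.ofAdd _ ↔ _
  rw [Multiplicative.ofAdd.injective.eq_iff, funext_iff]
  refine forall_congr' fun x => ?_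
  rw [sub_sub, Pi.zero_apply, sub_eq_zero]

/-- The quadratic relation, multiplied by `m`. On tuples which satisfy the linear relation it
becomes additive: the cocycle of `κ` summed over the coordinates is then the polarisation of
the quadratic form `∑ x, u x * u (x + 1)`. -/
def quadraticDefect (m : Fin 4) : C.linearDefect.ker →* Multiplicative (Fin 4) where
  toFun g := Multiplicative.ofAdd
    (m * (∑ x, C.κ (g.1 x) - ∑ x, C.β (g.1 x) * C.β (g.1 (x + 1))))
  map_one' := by
    rw [← ofAdd_zero]
    congr 1
    simp
  map_mul' g h := by
    rw [← ofAdd_add]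
    congr 1
    have hh := C.mem_ker_linearDefect.1 h.2
    simp only [Subgroup.coe_mul, Pi.mul_apply, C.β_mul, C.κ_mul, hh, Finset.sum_add_distrib]
    rw [sum_add_mul_add (fun x => C.β (g.1 x)) fun x => C.β (h.1 x)]
    ring

/-- The tuples which satisfy the linear relation, and `m` times the quadratic relation. -/
def relations (m : Fin 4) : Subgroup (Fin 4 → G) :=
  (C.quadraticDefect m).ker.map C.linearDefect.ker.subtype

theorem mem_relations {m : Fin 4} {g : Fin 4 → G} : g ∈ C.relations m ↔
    (∀ x, C.α (g x) = C.β (g (x + 1)) + C.β (g (x - 1))) ∧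
      m * (∑ x, C.κ (g x) - ∑ x, C.β (g x) * C.β (g (x + 1))) = 0 := by
  rw [relations, Subgroup.mem_map]
  constructor
  · rintro ⟨g, hg, rfl⟩
    exact ⟨C.mem_ker_linearDefect.1 g.2, hg⟩
  · rintro ⟨h, h'⟩
    exact ⟨⟨g, C.mem_ker_linearDefect.2 h⟩, h', rfl⟩

theorem index_ker_linearDefect : C.linearDefect.ker.index = 4 ^ 4 := by
  have h : C.linearDefect.range = ⊤ := by
    rw [MonoidHom.range_eq_top]
    intro u
    refine ⟨fun x => a ^ (u.toAdd x).val, ?_⟩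
    apply Multiplicative.toAdd.injective
    funext x
    simp [linearDefect, C.α_pow, C.β_pow, C.α_a, C.β_a]
  rw [Subgroup.index_ker, h, Subgroup.card_top]
  simp [Nat.card_eq_fintype_card]

theorem index_relations (m : Fin 4) :
    (C.relations m).index = 4 ^ 4 * Nat.card (Set.range fun t : Fin 4 => m * t) := by
  have h1 : C.relations m ≤ C.linearDefect.ker := by
    rintro _ ⟨g, -, rfl⟩
    exact g.2
  have h2 : (C.relations m).relIndex C.linearDefect.ker =
      Nat.card (Set.range fun t : Fin 4 => m * t) := by
    rw [Subgroup.relIndex, Subgroup.subgroupOf, relations,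
      Subgroup.comap_map_eq_self_of_injective (Subgroup.subtype_injective _),
      Subgroup.index_ker]
    refine Nat.card_congr (Equiv.subtypeEquiv Multiplicative.toAdd fun t => ?_)
    rw [MonoidHom.mem_range]
    constructor
    · rintro ⟨g, rfl⟩
      exact ⟨∑ x, C.κ (g.1 x) - ∑ x, C.β (g.1 x) * C.β (g.1 (x + 1)), rfl⟩
    · rintro ⟨t, ht⟩
      have hmem : Pi.mulSingle 0 ((b⁻¹ * a⁻¹ * b * a) ^ t.val) ∈ C.linearDefect.ker := by
        rw [C.mem_ker_linearDefect]
        intro x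
        simp only [Pi.mulSingle_apply]
        split_ifs <;> simp [C.α_pow, C.β_pow]
      refine ⟨⟨_, hmem⟩, ?_⟩
      apply Multiplicative.toAdd.injective
      rw [← ht]
      simp [quadraticDefect, Fin.sum_univ_four, C.κ_pow, C.β_pow]
  rw [← Subgroup.relIndex_mul_index h1, h2, C.index_ker_linearDefect, mul_comm]

variable {C} {D : Subgroup (Fin 4 → G)}

theorem IsBranching.le_relations (hD : C.IsBranching D) (m : Fin 4) : D ≤ C.relations m := by
  intro d hd
  rw [mem_relations]
  exact ⟨hD.linear d hd, by rw [hD.quadratic d hd, sub_self, mul_zero]⟩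

theorem IsBranching.rotate (hD : C.IsBranching D) {d : Fin 4 → G} (hd : d ∈ D) (t : Fin 4) :
    (fun x => d (x + t)) ∈ D := by
  have h : ∀ n : ℕ, (fun x => d (x + n)) ∈ D := by
    intro n
    induction n with
    | zero => simpa using hd
    | succ n ih =>
      convert hD.rot _ ih using 3 with x
      push_cast
      ring
  simpa using h t.val

theorem IsBranching.mulSingle_mem (hD : C.IsBranching D) {k : G} {i : Fin 4}
    (hk : Pi.mulSingle i k ∈ D) (j : Fin 4) : Pi.mulSingle j k ∈ D := by
  convert hD.rotate hk (i - j) using 1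
  funext x
  simp only [Pi.mulSingle_apply]
  congr 1
  apply propext
  constructor <;> intro h <;> linear_combination h

theorem IsBranching.exists_apply_zero (hD : C.IsBranching D) (g : G) : ∃ d ∈ D, d 0 = g := by
  have h : (⊤ : Subgroup G) ≤ D.map (Pi.evalMonoidHom _ 0) := by
    rw [← C.closure_eq, Subgroup.closure_le]
    rintro _ (rfl | rfl)
    · exact ⟨_, hD.gen, rfl⟩
    · exact ⟨_, hD.rotate hD.gen 3, rfl⟩
  exact h (Subgroup.mem_top g)

/-- The elements all of whose copies in the coordinates of the direct power lie in `D`. -/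
def branchingKernel (D : Subgroup (Fin 4 → G)) : Subgroup G :=
  ⨅ i, D.comap (MonoidHom.mulSingle (fun _ => G) i)

theorem mem_branchingKernel {k : G} :
    k ∈ branchingKernel D ↔ ∀ i, Pi.mulSingle i k ∈ D := by
  simp [branchingKernel, Subgroup.mem_iInf]

theorem IsBranching.normal_branchingKernel (hD : C.IsBranching D) :
    (branchingKernel D).Normal where
  conj_mem k hk g := by
    rw [mem_branchingKernel] at hk ⊢
    obtain ⟨d, hd, rfl⟩ := hD.exists_apply_zero g
    refine fun i => hD.mulSingle_mem (i := 0) ?_ i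
    convert D.mul_mem (D.mul_mem hd (hk 0)) (D.inv_mem hd) using 1
    funext x
    by_cases hx : x = 0
    · subst hx
      simp
    · simp [hx]

theorem pi_mem_of_branchingKernel {k : Fin 4 → G} (hk : ∀ x, k x ∈ branchingKernel D) :
    k ∈ D := by
  have h : Subgroup.pi Set.univ (fun _ => branchingKernel D) ≤ D := by
    rw [Subgroup.pi_le_iff]
    rintro i _ ⟨k, hk, rfl⟩
    exact mem_branchingKernel.1 hk i
  exact h fun x _ => hk x

/-- The commutator of the rotations `(a, 1, a, b)` and `(b, a, 1, a)`. -/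
theorem IsBranching.comm_mem (hD : C.IsBranching D) :
    ![b⁻¹ * a⁻¹ * b * a, 1, 1, (b⁻¹ * a⁻¹ * b * a)⁻¹] ∈ D := by
  have h0 := hD.gen
  have h3 := hD.rotate hD.gen 3
  convert D.mul_mem (D.mul_mem (D.mul_mem (D.inv_mem h3) (D.inv_mem h0)) h3) h0 using 1
  funext x
  fin_cases x <;> simp [mul_assoc]

/-- The rotation `(a, b, a, 1)` has trivial last coordinate, so its commutator with
`(c, 1, 1, c⁻¹)` is concentrated in coordinate `0`. -/
theorem IsBranching.comm_a_mem (hD : C.IsBranching D) :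
    (b⁻¹ * a⁻¹ * b * a)⁻¹ * a⁻¹ * (b⁻¹ * a⁻¹ * b * a) * a ∈ branchingKernel D := by
  rw [mem_branchingKernel]
  refine hD.mulSingle_mem (i := 0) ?_
  have h2 := hD.rotate hD.gen 2
  have hV := hD.comm_mem
  convert D.mul_mem (D.mul_mem (D.mul_mem (D.inv_mem hV) (D.inv_mem h2)) hV) h2 using 1
  funext x
  fin_cases x <;> simp [mul_assoc]

/-- The commutator of `(c, 1, 1, c⁻¹)` and `(b, a, 1, a)`, whose last coordinate may be removed
because it lies in the branching kernel by `IsBranching.comm_a_mem`. -/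
theorem IsBranching.comm_b_mem (hD : C.IsBranching D) :
    (b⁻¹ * a⁻¹ * b * a)⁻¹ * b⁻¹ * (b⁻¹ * a⁻¹ * b * a) * b ∈ branchingKernel D := by
  have := hD.normal_branchingKernel
  have hk : (b⁻¹ * a⁻¹ * b * a) * a⁻¹ * (b⁻¹ * a⁻¹ * b * a)⁻¹ * a ∈ branchingKernel D := by
    convert this.conj_mem _ ((branchingKernel D).inv_mem hD.comm_a_mem)
      (b⁻¹ * a⁻¹ * b * a) using 1
    group
  rw [mem_branchingKernel] at hk ⊢
  refine hD.mulSingle_mem (i := 0) ?_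
  have h3 := hD.rotate hD.gen 3
  have hV := hD.comm_mem
  convert D.mul_mem (D.mul_mem (D.mul_mem (D.mul_mem (D.inv_mem hV) (D.inv_mem h3)) hV) h3)
    (D.inv_mem (hk 3)) using 1
  funext x
  fin_cases x <;> simp [mul_assoc]

/-- The kernel of the homomorphism onto the Heisenberg group is contained in the branching
kernel. -/
theorem IsBranching.mem_branchingKernel_of_eq_zero (hD : C.IsBranching D) {g : G}
    (hα : C.α g = 0) (hβ : C.β g = 0) (hκ : C.κ g = 0) : g ∈ branchingKernel D := by
  have := hD.normal_branchingKernel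
  rw [← QuotientGroup.eq_one_iff, C.mk_eq _ hD.comm_a_mem hD.comm_b_mem, hα, hβ, hκ]
  simp

theorem IsBranching.mem_of_sum_eq_zero (hD : C.IsBranching D) {h : Fin 4 → G}
    (hα : ∀ x, C.α (h x) = 0) (hβ : ∀ x, C.β (h x) = 0) (hκ : ∑ x, C.κ (h x) = 0) :
    h ∈ D := by
  have hV := hD.comm_mem
  -- An element of `D` with the same coordinates as `h`; its exponents telescope.
  obtain ⟨w, hw, hwα, hwβ, hwκ⟩ : ∃ w ∈ D, (∀ x, C.α (w x) = 0) ∧ (∀ x, C.β (w x) = 0) ∧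
      ∀ x, C.κ (w x) = C.κ (h x) := by
    rw [Fin.sum_univ_four] at hκ
    refine ⟨_, D.mul_mem (D.mul_mem
      (D.pow_mem (hD.rotate hV 3) (C.κ (h 1) + C.κ (h 2) + C.κ (h 3)).val)
      (D.pow_mem (hD.rotate hV 2) (C.κ (h 2) + C.κ (h 3)).val))
      (D.pow_mem (hD.rotate hV 1) (C.κ (h 3)).val), fun x => ?_, fun x => ?_, fun x => ?_⟩
    · fin_cases x <;> simp [C.α_mul, C.α_pow, -mul_inv_rev]
    · fin_cases x <;> simp [C.β_mul, C.β_pow, -mul_inv_rev]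
    · fin_cases x <;> simp [C.κ_mul, C.β_mul, C.β_pow, C.κ_pow, C.κ_inv, C.α_a, C.α_b, C.β_a, C.β_b,
        -mul_inv_rev]
      · linear_combination -hκ
      all_goals ring
  rw [← inv_mul_cancel_right h w]
  refine D.mul_mem (pi_mem_of_branchingKernel fun x => ?_) hw
  apply hD.mem_branchingKernel_of_eq_zero
  · simp [C.α_mul, hα, hwα]
  · simp [C.β_mul, hβ, hwβ]
  · simp [C.κ_mul, C.κ_inv, hβ, hwβ, hwκ]

theorem IsBranching.exists_β_eq (hD : C.IsBranching D) (u : Fin 4 → Fin 4) :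
    ∃ d ∈ D, ∀ x, C.β (d x) = u x := by
  refine ⟨_, D.mul_mem (D.mul_mem (D.mul_mem (D.pow_mem (hD.rotate hD.gen 3) (u 0).val)
    (D.pow_mem (hD.rotate hD.gen 2) (u 1).val)) (D.pow_mem (hD.rotate hD.gen 1) (u 2).val))
    (D.pow_mem hD.gen (u 3).val), fun x => ?_⟩
  fin_cases x <;> simp [C.β_mul, C.β_pow, C.β_a, C.β_b]

/-- The relations satisfied modulo a subgroup `L` in each coordinate. The hypotheses say that `L` has
trivial coordinates `α` and `β`, and that its central coordinates are the annihilator of `m`. -/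
theorem IsBranching.sup_pi_eq (hD : C.IsBranching D) (L : Subgroup G) (m : Fin 4)
    (h1 : ∀ s ∈ L, C.α s = 0 ∧ C.β s = 0 ∧ m * C.κ s = 0)
    (h2 : ∀ t, m * t = 0 → ∃ s ∈ L, C.κ s = t) :
    D ⊔ Subgroup.pi Set.univ (fun _ => L) = C.relations m := by
  apply le_antisymm
  · refine sup_le (hD.le_relations m) fun g hg => ?_
    rw [mem_relations]
    have hg' : ∀ x, g x ∈ L := fun x => hg x trivial
    refine ⟨fun x => by simp [h1 _ (hg' _)], ?_⟩
    simp [h1 _ (hg' _), Finset.mul_sum]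
  · intro g hg
    -- After division by an element of `D`, and then by one of `L` in coordinate `0`, all coordinates
    -- `α` and `β` vanish, and so does the sum of the coordinates `κ`.
    obtain ⟨d, hd, hdβ⟩ := hD.exists_β_eq fun x => C.β (g x)
    have hgd := (C.relations m).mul_mem hg ((C.relations m).inv_mem (hD.le_relations m hd))
    rw [mem_relations] at hgd
    obtain ⟨hlin, hquad⟩ := hgd
    have hβ : ∀ x, C.β ((g * d⁻¹) x) = 0 := by
      intro x
      simp [C.β_mul, hdβ]
    simp only [hβ, mul_zero, Finset.sum_const_zero, sub_zero, add_zero] at hlin hquad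
    obtain ⟨s, hs, hsκ⟩ := h2 _ hquad
    obtain ⟨hs1, hs2, -⟩ := h1 s hs
    have hsm : Pi.mulSingle 0 s ∈ Subgroup.pi Set.univ (fun _ : Fin 4 => L) :=
      (Subgroup.mulSingle_mem_pi (η := Fin 4) (f := fun _ => G) 0 s).2 fun _ => hs
    have hmem : g * d⁻¹ * (Pi.mulSingle 0 s)⁻¹ ∈ D := by
      have hα0 : ∀ x, C.α ((Pi.mulSingle 0 s : Fin 4 → G) x) = 0 := by
        intro x
        rw [Pi.mulSingle_apply]
        split_ifs <;> simp [hs1]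
      have hβ0 : ∀ x, C.β ((Pi.mulSingle 0 s : Fin 4 → G) x) = 0 := by
        intro x
        rw [Pi.mulSingle_apply]
        split_ifs <;> simp [hs2]
      refine hD.mem_of_sum_eq_zero (fun x => ?_) (fun x => ?_) ?_
      · rw [Pi.mul_apply, C.α_mul, hlin, Pi.inv_apply, C.α_inv, hα0]; simp
      · rw [Pi.mul_apply, C.β_mul, hβ, Pi.inv_apply, C.β_inv, hβ0]; simp
      · simp only [Pi.mul_apply (g * d⁻¹), C.κ_mul, hβ, zero_mul, add_zero,
          Finset.sum_add_distrib, ← hsκ]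
        simp [Fin.sum_univ_four, C.κ_inv, hs2]
    have : g = g * d⁻¹ * (Pi.mulSingle 0 s)⁻¹ * Pi.mulSingle 0 s * d := by group
    rw [this]
    exact Subgroup.mul_mem _ (Subgroup.mul_mem _ (Subgroup.mem_sup_left hmem)
      (Subgroup.mem_sup_right hsm)) (Subgroup.mem_sup_left hd)

end HeisenbergCoords

namespace Grigorchuk

/-! ### Sections and labels of tree automorphisms -/

/-- The action of a tree automorphism on the first level. -/
def letter (f : TreeAut) (x : Fin 4) : Fin 4 := (f [x]).headI

theorem apply_singleton (f : TreeAut) (x : Fin 4) : f [x] = [letter f x] := by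
  obtain ⟨y, hy⟩ := List.length_eq_one_iff.1 (length_apply f [x])
  simp [letter, hy]

theorem apply_cons_tail (f : TreeAut) (x : Fin 4) (w : Word) :
    f (x :: w) = letter f x :: (f (x :: w)).tail := by
  have h : f [x] <+: f (x :: w) := f.map_rel_iff.2 (List.prefix_append [x] w)
  rw [apply_singleton] at h
  obtain ⟨t, ht⟩ := h
  rw [← ht]
  rfl

theorem letter_mul (f g : TreeAut) (x : Fin 4) : letter (f * g) x = letter f (letter g x) := by
  have h := apply_singleton (f * g) x
  rw [RelIso.mul_apply, apply_singleton, apply_singleton] at h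
  simpa using h.symm

@[simp] theorem letter_one (x : Fin 4) : letter 1 x = x := rfl

/-- The section of a tree automorphism at a vertex `x` of the first level: its action on the
subtree rooted at `x`, both this subtree and its image being identified with the whole tree. -/
def sec (f : TreeAut) (x : Fin 4) : TreeAut where
  toFun w := (f (x :: w)).tail
  invFun w := (f⁻¹ (letter f x :: w)).tail
  left_inv w := by
    change (f⁻¹ (letter f x :: (f (x :: w)).tail)).tail = w
    rw [← apply_cons_tail, RelIso.inv_apply_self, List.tail_cons]
  right_inv w := by
    have h : x = letter f⁻¹ (letter f x) := by rw [← letter_mul, inv_mul_cancel, letter_one]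
    change (f (x :: (f⁻¹ (letter f x :: w)).tail)).tail = w
    nth_rw 1 [h]
    rw [← apply_cons_tail, RelIso.apply_inv_self, List.tail_cons]
  map_rel_iff' {u v} := by
    have h := f.map_rel_iff (a := x :: u) (b := x :: v)
    rw [apply_cons_tail f x u, apply_cons_tail f x v, List.cons_prefix_cons,
      List.cons_prefix_cons] at h
    simpa using h

theorem apply_cons (f : TreeAut) (x : Fin 4) (w : Word) :
    f (x :: w) = letter f x :: sec f x w := apply_cons_tail f x w

theorem sec_mul (f g : TreeAut) (x : Fin 4) :
    sec (f * g) x = sec f (letter g x) * sec g x := by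
  ext1 w
  have h := apply_cons (f * g) x w
  rw [RelIso.mul_apply, apply_cons, apply_cons] at h
  exact (List.cons.inj h).2.symm

@[simp] theorem sec_one (x : Fin 4) : sec 1 x = 1 := rfl

theorem sec_inv (f : TreeAut) (x : Fin 4) : sec f⁻¹ x = (sec f (letter f⁻¹ x))⁻¹ := by
  rw [eq_inv_iff_mul_eq_one, mul_eq_one_iff_eq_inv', ← mul_eq_one_iff_eq_inv, ← sec_mul,
    mul_inv_cancel, sec_one]

theorem mem_levelStab_succ {n : ℕ} {f : TreeAut} :
    f ∈ levelStab (n + 1) ↔ (∀ x, letter f x = x) ∧ ∀ x, sec f x ∈ levelStab n := by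
  constructor
  · intro hf
    have h : ∀ (x : Fin 4) (w : Word), w.length = n → letter f x = x ∧ sec f x w = w := by
      intro x w hw
      have := hf (x :: w) (by simp [hw])
      rw [apply_cons] at this
      exact List.cons.inj this
    exact ⟨fun x => (h x (List.replicate n 0) (by simp)).1, fun x w hw => (h x w hw).2⟩
  · rintro ⟨h1, h2⟩ w hw
    cases w with
    | nil => simp at hw
    | cons x w =>
      rw [apply_cons, h1, h2 x w (by simpa using hw)]

theorem levelStab_zero : levelStab 0 = ⊤ := by
  refine eq_top_iff.2 fun f _ w hw => ?_
  rw [List.length_eq_zero_iff] at hw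
  subst hw
  exact List.length_eq_zero_iff.1 (length_apply f [])

/-- The label of an automorphism in `Γ` at the root, as an exponent of the cycle `(0 1 2 3)`. -/
def rootLabel (f : TreeAut) : Fin 4 := letter f 0

theorem exists_add_of_mem_zpowers {σ : Equiv.Perm (Fin 4)}
    (hσ : σ ∈ Subgroup.zpowers (finRotate 4)) : ∃ t : Fin 4, ∀ x, σ x = x + t := by
  rw [Subgroup.zpowers_eq_closure] at hσ
  induction hσ using Subgroup.closure_induction with
  | mem σ h =>
    rw [Set.mem_singleton_iff] at h
    exact ⟨1, fun x => by rw [h, finRotate_apply]⟩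
  | one => exact ⟨0, fun x => by simp⟩
  | mul σ τ _ _ h1 h2 =>
    obtain ⟨s, hs⟩ := h1
    obtain ⟨t, ht⟩ := h2
    exact ⟨t + s, fun x => by rw [Equiv.Perm.mul_apply, ht, hs, add_assoc]⟩
  | inv σ _ h =>
    obtain ⟨s, hs⟩ := h
    exact ⟨-s, fun x => by rw [Equiv.Perm.inv_eq_iff_eq, hs, neg_add_cancel_right]⟩

theorem letter_eq {f : TreeAut} (hf : f ∈ Gamma) (x : Fin 4) : letter f x = x + rootLabel f := by
  obtain ⟨σ, hσ, h⟩ := hf []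
  obtain ⟨t, ht⟩ := exists_add_of_mem_zpowers hσ
  have h1 : ∀ y, letter f y = y + t := by
    intro y
    have h2 := h y
    rw [List.length_eq_zero_iff.1 (length_apply f []), List.nil_append, apply_singleton,
      List.nil_append, ht] at h2
    simpa using h2
  rw [rootLabel, h1, h1, zero_add]

theorem rootLabel_mul {f g : TreeAut} (hf : f ∈ Gamma) :
    rootLabel (f * g) = rootLabel f + rootLabel g := by
  rw [rootLabel, letter_mul, letter_eq hf, ← rootLabel, add_comm]

@[simp] theorem rootLabel_one : rootLabel 1 = 0 := rfl

theorem rootLabel_inv {f : TreeAut} (hf : f ∈ Gamma) : rootLabel f⁻¹ = -rootLabel f := by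
  have h := rootLabel_mul (g := f⁻¹) hf
  rw [mul_inv_cancel, rootLabel_one] at h
  linear_combination -h

theorem sec_mem_Gamma {f : TreeAut} (hf : f ∈ Gamma) (x : Fin 4) : sec f x ∈ Gamma := by
  intro w
  obtain ⟨σ, hσ, h⟩ := hf (x :: w)
  refine ⟨σ, hσ, fun y => ?_⟩
  have h1 := h y
  rw [List.cons_append, apply_cons, apply_cons, List.cons_append] at h1
  exact (List.cons.inj h1).2

theorem mem_levelStab_one {f : TreeAut} (hf : f ∈ Gamma) :
    f ∈ levelStab 1 ↔ rootLabel f = 0 := by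
  rw [mem_levelStab_succ, levelStab_zero]
  simp [letter_eq hf]

theorem letter_genA (x : Fin 4) : letter genA x = x + 1 := by
  revert x; decide

@[simp] theorem sec_genA (x : Fin 4) : sec genA x = 1 := rfl

@[simp] theorem sec_genB_zero : sec genB 0 = genA := rfl

@[simp] theorem sec_genB_one : sec genB 1 = 1 := rfl

@[simp] theorem sec_genB_two : sec genB 2 = genA := rfl

@[simp] theorem sec_genB_three : sec genB 3 = genB := rfl

theorem genA_pow_four : genA ^ 4 = 1 := by
  ext1 w
  change aFun (aFun (aFun (aFun w))) = w
  cases w with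
  | nil => rfl
  | cons x w => fin_cases x <;> rfl

theorem genB_pow_four : genB ^ 4 = 1 := by
  ext1 w
  change bFun (bFun (bFun (bFun w))) = w
  have ha : ∀ w, aFun (aFun (aFun (aFun w))) = w := fun w => DFunLike.congr_fun genA_pow_four w
  induction w with
  | nil => rfl
  | cons x w ih => fin_cases x <;> simp [bFun, ha, ih]

theorem genA_mem : genA ∈ secondGrigorchuk := Subgroup.subset_closure (by simp)

theorem genB_mem : genB ∈ secondGrigorchuk := Subgroup.subset_closure (by simp)

/-! ### Congruence quotients of self-similar groups -/

/-- A group of tree automorphisms is self-similar if it contains the sections of its elements. -/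
def IsSelfSimilar (H : Subgroup TreeAut) : Prop := ∀ f ∈ H, ∀ x, sec f x ∈ H

theorem isSelfSimilar_Gamma : IsSelfSimilar Gamma := fun _ hf x => sec_mem_Gamma hf x

theorem isSelfSimilar_secondGrigorchuk : IsSelfSimilar secondGrigorchuk := by
  intro f hf
  induction hf using Subgroup.closure_induction with
  | mem f h =>
    rcases h with rfl | rfl
    · exact fun x => one_mem _
    · intro x
      fin_cases x
      exacts [genA_mem, one_mem _, genA_mem, genB_mem]
  | one => exact fun x => one_mem _
  | mul f g _ _ hf hg => exact fun x => sec_mul f g x ▸ mul_mem (hf _) (hg _)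
  | inv f _ hf => exact fun x => sec_inv f x ▸ inv_mem (hf _)

/-- The embedding of the first level stabiliser of a self-similar group into the direct power of
the group, given by the sections at the vertices of the first level. -/
def sections {H : Subgroup TreeAut} (hH : IsSelfSimilar H) :
    ↥(levelStab 1 ⊓ H) →* (Fin 4 → H) where
  toFun f x := ⟨sec f x, hH f f.2.2 x⟩
  map_one' := rfl
  map_mul' f g := by
    funext x
    apply Subtype.ext
    simp only [Subgroup.coe_mul, sec_mul, Pi.mul_apply]
    rw [(mem_levelStab_succ.1 g.2.1).1]

theorem congruenceIndex_one {H : Subgroup TreeAut} (hH : H ≤ Gamma) (ha : genA ∈ H) :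
    congruenceIndex H 1 = 4 := by
  let φ : H →* Multiplicative (Fin 4) :=
    { toFun := fun f => Multiplicative.ofAdd (rootLabel f)
      map_one' := rfl
      map_mul' := fun f g => congrArg Multiplicative.ofAdd (rootLabel_mul (hH f.2)) }
  have hker : (levelStab 1).subgroupOf H = φ.ker := by
    ext f
    rw [Subgroup.mem_subgroupOf, mem_levelStab_one (hH f.2)]
    rfl
  have hrange : φ.range = ⊤ := by
    have h : φ ⟨genA, ha⟩ = Multiplicative.ofAdd 1 := rfl
    rw [MonoidHom.range_eq_top]
    intro t
    refine ⟨⟨genA, ha⟩ ^ t.toAdd.val, ?_⟩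
    rw [map_pow, h, ← ofAdd_nsmul]
    simp
  rw [congruenceIndex, hker, Subgroup.index_ker, hrange, Subgroup.card_top]
  simp [Nat.card_eq_fintype_card]

/-- The factor `4` is the order of the group induced on the first level. -/
theorem congruenceIndex_succ {H : Subgroup TreeAut} (hs : IsSelfSimilar H) (hH : H ≤ Gamma)
    (ha : genA ∈ H) (n : ℕ) :
    congruenceIndex H (n + 1) = 4 * (Subgroup.pi Set.univ fun _ : Fin 4 =>
      (levelStab n).subgroupOf H).relIndex (sections hs).range := by
  have h1 : (levelStab (n + 1)).relIndex (levelStab 1 ⊓ H) =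
      (Subgroup.pi Set.univ fun _ : Fin 4 =>
        (levelStab n).subgroupOf H).relIndex (sections hs).range := by
    rw [← Subgroup.index_comap, Subgroup.relIndex]
    congr 1
    ext f
    rw [Subgroup.mem_subgroupOf, mem_levelStab_succ, Subgroup.mem_comap, Subgroup.mem_pi]
    have hf := (mem_levelStab_succ.1 f.2.1).1
    constructor
    · exact fun h x _ => h.2 x
    · exact fun h => ⟨hf, fun x => h x trivial⟩
  have h2 : levelStab (n + 1) ⊓ H ≤ levelStab 1 ⊓ H :=
    inf_le_inf_right _ (levelStab_antitone (by omega))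
  have h3 := Subgroup.relIndex_mul_relIndex _ _ _ h2 inf_le_right
  rw [Subgroup.inf_relIndex_right, Subgroup.inf_relIndex_right] at h3
  have h4 : (levelStab 1).relIndex H = 4 := congruenceIndex_one hH ha
  have h5 : (levelStab (n + 1) ⊓ H).relIndex (levelStab 1 ⊓ H) =
      (levelStab (n + 1)).relIndex (levelStab 1 ⊓ H) := by
    rw [← Subgroup.inf_relIndex_right (levelStab (n + 1)) (levelStab 1 ⊓ H), ← inf_assoc,
      inf_eq_left.2 (levelStab_antitone (Nat.le_add_left 1 n))]
  rw [h4] at h3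
  rw [← h1, ← h5, mul_comm, h3]
  rfl

/-- The automorphism which fixes the first level and has prescribed sections there. -/
def glue (s : Fin 4 → TreeAut) : TreeAut where
  toFun
    | [] => []
    | x :: w => x :: s x w
  invFun
    | [] => []
    | x :: w => x :: (s x)⁻¹ w
  left_inv w := by cases w <;> simp
  right_inv w := by cases w <;> simp
  map_rel_iff' {u v} := by
    cases u <;> cases v <;> simp [List.cons_prefix_cons]
    rintro rfl
    exact (s _).map_rel_iff

theorem glue_mem_Gamma {s : Fin 4 → TreeAut} (hs : ∀ x, s x ∈ Gamma) : glue s ∈ Gamma := by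
  rintro (_ | ⟨x, w⟩)
  · exact ⟨1, one_mem _, fun x => congrArg (List.cons x)
      (List.length_eq_zero_iff.1 (length_apply (s x) []))⟩
  · obtain ⟨σ, hσ, h⟩ := hs x w
    exact ⟨σ, hσ, fun y => congrArg (List.cons x) (h y)⟩

theorem glue_mem_levelStab_one (s : Fin 4 → TreeAut) : glue s ∈ levelStab 1 := by
  rw [mem_levelStab_succ, levelStab_zero]
  exact ⟨fun x => rfl, fun x => trivial⟩

theorem genA_mem_Gamma : genA ∈ Gamma := secondGrigorchuk_le_Gamma genA_mem

theorem congruenceIndex_Gamma_succ (n : ℕ) :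
    congruenceIndex Gamma (n + 1) = 4 * congruenceIndex Gamma n ^ 4 := by
  have h : (sections isSelfSimilar_Gamma).range = ⊤ := by
    rw [MonoidHom.range_eq_top]
    exact fun s => ⟨⟨glue fun x => s x, glue_mem_levelStab_one _,
      glue_mem_Gamma fun x => (s x).2⟩, rfl⟩
  rw [congruenceIndex_succ isSelfSimilar_Gamma le_rfl genA_mem_Gamma, h,
    Subgroup.relIndex_top_right, Subgroup.index_pi]
  simp [congruenceIndex]

theorem congruenceIndex_zero (H : Subgroup TreeAut) : congruenceIndex H 0 = 1 := by
  simp [congruenceIndex, levelStab_zero]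

/-- A dense subgroup has the same congruence quotients, since level stabilisers are open. -/
theorem congruenceIndex_topologicalClosure (H : Subgroup TreeAut) (n : ℕ) :
    congruenceIndex H.topologicalClosure n = congruenceIndex H n := by
  have hopen : IsOpen ((H ⊔ levelStab n : Subgroup TreeAut) : Set TreeAut) := by
    apply Subgroup.isOpen_of_mem_nhds _ (g := 1)
    have hstab : (levelStab n : Set TreeAut) ∈ levelBasis := ⟨n, rfl⟩
    exact Filter.mem_of_superset (levelBasis.mem_nhds_one hstab)
      (SetLike.coe_subset_coe.2 le_sup_right)
  have hle : H.topologicalClosure ≤ H ⊔ levelStab n :=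
    H.topologicalClosure_minimal le_sup_left (Subgroup.isClosed_of_isOpen _ hopen)
  have hsup : H.topologicalClosure ⊔ levelStab n = H ⊔ levelStab n :=
    le_antisymm (sup_le hle le_sup_right) (sup_le_sup_right H.le_topologicalClosure _)
  change (levelStab n).relIndex _ = (levelStab n).relIndex _
  rw [← Subgroup.relIndex_sup_right, hsup, Subgroup.relIndex_sup_right]

/-! ### Heisenberg coordinates on the second Grigorchuk group -/

/-- The exponent sum of `b`, read off from the labels on the first level. -/
def exponentB (f : TreeAut) : Fin 4 := rootLabel (sec f 0) + rootLabel (sec f 1)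

/-- The central Heisenberg coordinate, read off from the labels on the second level. The weight
`x + 1` makes it vanish at `b`, whose section at `3` is `b` itself. -/
def central (f : TreeAut) : Fin 4 := -∑ x, (x + 1) * exponentB (sec f x)

variable {f g : TreeAut}

theorem sec_mem (hf : f ∈ secondGrigorchuk) (x : Fin 4) : sec f x ∈ secondGrigorchuk :=
  isSelfSimilar_secondGrigorchuk f hf x

theorem sec_mul' (hg : g ∈ secondGrigorchuk) (x : Fin 4) :
    sec (f * g) x = sec f (x + rootLabel g) * sec g x := by
  rw [sec_mul, letter_eq (secondGrigorchuk_le_Gamma hg)]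

theorem sec_inv' (hf : f ∈ secondGrigorchuk) (x : Fin 4) :
    sec f⁻¹ x = (sec f (x + rootLabel f⁻¹))⁻¹ := by
  rw [sec_inv, letter_eq (secondGrigorchuk_le_Gamma (inv_mem hf))]

theorem rootLabel_mul' (hf : f ∈ secondGrigorchuk) :
    rootLabel (f * g) = rootLabel f + rootLabel g :=
  rootLabel_mul (secondGrigorchuk_le_Gamma hf)

theorem rootLabel_inv' (hf : f ∈ secondGrigorchuk) : rootLabel f⁻¹ = -rootLabel f :=
  rootLabel_inv (secondGrigorchuk_le_Gamma hf)

theorem rootLabel_sec_add_two (hf : f ∈ secondGrigorchuk) (x : Fin 4) :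
    rootLabel (sec f (x + 2)) = rootLabel (sec f x) := by
  induction hf using Subgroup.closure_induction generalizing x with
  | mem f h =>
    rcases h with rfl | rfl
    · rfl
    · fin_cases x <;> rfl
  | one => rfl
  | mul f g hf hg ihf ihg =>
    rw [sec_mul' hg, sec_mul' hg, rootLabel_mul' (sec_mem hf _), rootLabel_mul' (sec_mem hf _), ihg,
      add_right_comm, ihf]
  | inv f hf ih =>
    rw [sec_inv' hf, sec_inv' hf, rootLabel_inv' (sec_mem hf _), rootLabel_inv' (sec_mem hf _),
      add_right_comm, ih]

theorem exponentB_eq (hf : f ∈ secondGrigorchuk) (x : Fin 4) :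
    exponentB f = rootLabel (sec f x) + rootLabel (sec f (1 + x)) := by
  have h0 : rootLabel (sec f 2) = rootLabel (sec f 0) := rootLabel_sec_add_two hf 0
  have h1 : rootLabel (sec f 3) = rootLabel (sec f 1) := rootLabel_sec_add_two hf 1
  fin_cases x
  · rfl
  · change rootLabel (sec f 0) + rootLabel (sec f 1) =
      rootLabel (sec f 1) + rootLabel (sec f 2)
    rw [h0, add_comm]
  · change rootLabel (sec f 0) + rootLabel (sec f 1) =
      rootLabel (sec f 2) + rootLabel (sec f 3)
    rw [h0, h1]
  · change rootLabel (sec f 0) + rootLabel (sec f 1) =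
      rootLabel (sec f 3) + rootLabel (sec f 0)
    rw [h1, add_comm]

theorem exponentB_mul (hf : f ∈ secondGrigorchuk) (hg : g ∈ secondGrigorchuk) :
    exponentB (f * g) = exponentB f + exponentB g := by
  rw [exponentB, sec_mul' hg, sec_mul' hg, rootLabel_mul' (sec_mem hf _),
    rootLabel_mul' (sec_mem hf _), exponentB_eq hf (0 + rootLabel g), exponentB, zero_add]
  ring

theorem exponentB_inv (hf : f ∈ secondGrigorchuk) : exponentB f⁻¹ = -exponentB f := by
  have h := exponentB_mul hf (inv_mem hf)
  rw [mul_inv_cancel, show exponentB 1 = 0 from rfl] at h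
  linear_combination -h

@[simp] theorem exponentB_genA : exponentB genA = 0 := rfl

@[simp] theorem exponentB_genB : exponentB genB = 1 := rfl

/-- The linear relation between the Heisenberg coordinates of the sections. -/
theorem rootLabel_sec_eq (hf : f ∈ secondGrigorchuk) (x : Fin 4) :
    rootLabel (sec f x) = exponentB (sec f (x + 1)) + exponentB (sec f (x - 1)) := by
  induction hf using Subgroup.closure_induction generalizing x with
  | mem f h =>
    rcases h with rfl | rfl
    · rfl
    · fin_cases x <;> rfl
  | one => rfl
  | mul f g hf hg ihf ihg =>
    rw [sec_mul' hg, sec_mul' hg, sec_mul' hg, rootLabel_mul' (sec_mem hf _),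
      exponentB_mul (sec_mem hf _) (sec_mem hg _), exponentB_mul (sec_mem hf _) (sec_mem hg _),
      ihf, ihg, add_right_comm x _ 1, add_sub_right_comm]
    ring
  | inv f hf ih =>
    rw [sec_inv' hf, sec_inv' hf, sec_inv' hf, rootLabel_inv' (sec_mem hf _),
      exponentB_inv (sec_mem hf _), exponentB_inv (sec_mem hf _), ih, add_right_comm x _ 1,
      add_sub_right_comm]
    ring

theorem sum_exponentB_sec (hf : f ∈ secondGrigorchuk) :
    ∑ x, exponentB (sec f x) = exponentB f := by
  rw [exponentB, rootLabel_sec_eq hf, rootLabel_sec_eq hf, Fin.sum_univ_four]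
  change _ = exponentB (sec f 1) + exponentB (sec f 3) +
    (exponentB (sec f 2) + exponentB (sec f 0))
  ring

theorem central_mul (hf : f ∈ secondGrigorchuk) (hg : g ∈ secondGrigorchuk) :
    central (f * g) = central f + central g + exponentB f * rootLabel g := by
  have h := sum_add_right (fun y => (y - rootLabel g + 1) * exponentB (sec f y)) (rootLabel g)
  have h' : ∑ x, (x - rootLabel g + 1) * exponentB (sec f x) =
      ∑ x, (x + 1) * exponentB (sec f x) - rootLabel g * exponentB f := by
    rw [← sum_exponentB_sec hf, Finset.mul_sum, ← Finset.sum_sub_distrib]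
    exact Finset.sum_congr rfl fun x _ => by ring
  simp only [add_sub_cancel_right] at h
  simp only [central, sec_mul' hg, exponentB_mul (sec_mem hf _) (sec_mem hg _), mul_add,
    Finset.sum_add_distrib]
  rw [h, h']
  ring

theorem central_inv (hf : f ∈ secondGrigorchuk) :
    central f⁻¹ = -central f + exponentB f * rootLabel f := by
  have h := central_mul hf (inv_mem hf)
  rw [mul_inv_cancel, show central 1 = 0 from rfl, rootLabel_inv' hf] at h
  linear_combination -h

@[simp] theorem central_genA : central genA = 0 := rfl

@[simp] theorem central_genB : central genB = 0 := by decide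

@[simp] theorem central_one : central 1 = 0 := rfl

/-- The quadratic relation between the Heisenberg coordinates of the sections. -/
theorem sum_central_sec (hf : f ∈ secondGrigorchuk) :
    ∑ x, central (sec f x) = ∑ x, exponentB (sec f x) * exponentB (sec f (x + 1)) := by
  induction hf using Subgroup.closure_induction with
  | mem f h =>
    rcases h with rfl | rfl
    · rfl
    · simp [Fin.sum_univ_four]
  | one => rfl
  | mul f g hf hg ihf ihg =>
    have h1 := sum_add_right (fun y => central (sec f y)) (rootLabel g)
    have h2 := sum_add_right (fun y => exponentB (sec f y) * exponentB (sec f (y + 1)))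
      (rootLabel g)
    simp only [sec_mul' hg, exponentB_mul (sec_mem hf _) (sec_mem hg _),
      central_mul (sec_mem hf _) (sec_mem hg _), rootLabel_sec_eq hg, Finset.sum_add_distrib]
    rw [sum_add_mul_add (fun x => exponentB (sec f (x + rootLabel g)))
      fun x => exponentB (sec g x), h1, ihf, ihg, ← h2]
    simp only [add_right_comm _ (1 : Fin 4)]
  | inv f hf ih =>
    have h1 := sum_add_right (fun y => central (sec f y)) (rootLabel f⁻¹)
    have h2 := sum_add_right (fun y => exponentB (sec f y) * exponentB (sec f (y + 1)))
      (rootLabel f⁻¹)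
    have h3 := sum_add_right (fun y => exponentB (sec f y) * rootLabel (sec f y))
      (rootLabel f⁻¹)
    simp only [sec_inv' hf, exponentB_inv (sec_mem hf _), central_inv (sec_mem hf _),
      Finset.sum_add_distrib, add_right_comm _ (1 : Fin 4), Finset.sum_neg_distrib, neg_mul_neg]
    rw [h1, h2, h3, ih]
    simp only [rootLabel_sec_eq hf]
    rw [sum_mul_add_neighbours fun x => exponentB (sec f x)]
    ring

/-- The Heisenberg coordinates on the second Grigorchuk group. -/
def coords : HeisenbergCoords secondGrigorchuk ⟨genA, genA_mem⟩ ⟨genB, genB_mem⟩ where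
  α f := rootLabel f
  β f := exponentB f
  κ f := central f
  α_mul f _ := rootLabel_mul' f.2
  β_mul f g := exponentB_mul f.2 g.2
  κ_mul f g := central_mul f.2 g.2
  α_a := rfl
  β_a := rfl
  κ_a := rfl
  α_b := rfl
  β_b := rfl
  κ_b := central_genB
  closure_eq := by
    refine Eq.trans (congrArg Subgroup.closure (Set.ext fun f => ?_))
      (Subgroup.closure_closure_coe_preimage (k := ({genA, genB} : Set TreeAut)))
    simp only [Set.mem_insert_iff, Set.mem_singleton_iff, Subtype.ext_iff]
    rfl
  a_pow := Subtype.ext genA_pow_four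
  b_pow := Subtype.ext genB_pow_four

theorem sec_conj_genA (f : TreeAut) (x : Fin 4) : sec (genA⁻¹ * f * genA) x = sec f (x + 1) := by
  rw [sec_mul, sec_mul, sec_inv]
  simp [letter_genA]

theorem isBranching : coords.IsBranching (sections isSelfSimilar_secondGrigorchuk).range where
  rot := by
    rintro _ ⟨f, rfl⟩
    have h : genA⁻¹ * f.1 * genA ∈ levelStab 1 ⊓ secondGrigorchuk := by
      refine ⟨?_, secondGrigorchuk.mul_mem (secondGrigorchuk.mul_mem
        (secondGrigorchuk.inv_mem genA_mem) f.2.2) genA_mem⟩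
      simpa using (levelStab_normal 1).conj_mem f.1 f.2.1 genA⁻¹
    exact ⟨⟨_, h⟩, funext fun x => Subtype.ext (sec_conj_genA f x)⟩
  gen := by
    refine ⟨⟨genB, ?_, genB_mem⟩, ?_⟩
    · exact (mem_levelStab_one (secondGrigorchuk_le_Gamma genB_mem)).2 rfl
    · funext x
      fin_cases x <;> rfl
  linear := by
    rintro _ ⟨f, rfl⟩
    exact rootLabel_sec_eq f.2.2
  quadratic := by
    rintro _ ⟨f, rfl⟩
    exact sum_central_sec f.2.2

theorem rootLabel_eq_zero {n : ℕ} (h : f ∈ levelStab (n + 1)) : rootLabel f = 0 :=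
  (mem_levelStab_succ.1 h).1 0

theorem exponentB_eq_zero {n : ℕ} (h : f ∈ levelStab (n + 2)) : exponentB f = 0 := by
  have h' := (mem_levelStab_succ.1 h).2
  rw [exponentB, rootLabel_eq_zero (h' 0), rootLabel_eq_zero (h' 1), add_zero]

theorem central_eq_zero {n : ℕ} (h : f ∈ levelStab (n + 3)) : central f = 0 := by
  have h' := (mem_levelStab_succ.1 h).2
  simp [central, exponentB_eq_zero (h' _)]

/-- On the second level stabiliser the central coordinate only takes even values. -/
theorem two_mul_central_eq_zero (hf : f ∈ secondGrigorchuk) (h : f ∈ levelStab 2) :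
    2 * central f = 0 := by
  have h1 := rootLabel_sec_eq hf 1
  rw [rootLabel_eq_zero ((mem_levelStab_succ.1 h).2 1)] at h1
  change 0 = exponentB (sec f 2) + exponentB (sec f 0) at h1
  rw [central, Fin.sum_univ_four]
  linear_combination 2 * h1 - (exponentB (sec f 1) + exponentB (sec f 2) +
    2 * exponentB (sec f 3) + exponentB (sec f 0) * 0) * four_eq_zero

/-- The element `(1, b, 1, b⁻¹)` of the second level stabiliser has central coordinate `2`. -/
theorem exists_central_eq_two : ∃ f ∈ secondGrigorchuk, f ∈ levelStab 2 ∧ central f = 2 := by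
  have hab : genA⁻¹ * genB * genA ∈ secondGrigorchuk :=
    mul_mem (mul_mem (inv_mem genA_mem) genB_mem) genA_mem
  have haab : genA⁻¹ * (genA⁻¹ * genB * genA) * genA ∈ secondGrigorchuk :=
    mul_mem (mul_mem (inv_mem genA_mem) hab) genA_mem
  have hmem := mul_mem haab (inv_mem genB_mem)
  set f := genA⁻¹ * (genA⁻¹ * genB * genA) * genA * genB⁻¹ with hf
  have hsec : ∀ x, sec f x = sec genB (x + 2) * (sec genB x)⁻¹ := by
    intro x
    rw [hf, sec_mul' (inv_mem genB_mem), sec_inv' genB_mem, sec_conj_genA, sec_conj_genA,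
      show rootLabel genB⁻¹ = 0 by rw [rootLabel_inv' genB_mem]; rfl, add_zero, add_assoc]
    rfl
  have hroot : rootLabel f = 0 := by
    rw [hf, rootLabel_mul' haab, rootLabel_mul' (mul_mem (inv_mem genA_mem) hab),
      rootLabel_mul' (inv_mem genA_mem), rootLabel_mul' (mul_mem (inv_mem genA_mem) genB_mem),
      rootLabel_mul' (inv_mem genA_mem), rootLabel_inv' genA_mem, rootLabel_inv' genB_mem]
    rfl
  refine ⟨f, hmem, ?_, ?_⟩
  · rw [mem_levelStab_succ]
    refine ⟨fun x => by rw [letter_eq (secondGrigorchuk_le_Gamma hmem), hroot, add_zero],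
      fun x => ?_⟩
    rw [mem_levelStab_one (sec_mem_Gamma (secondGrigorchuk_le_Gamma hmem) x), hsec,
      rootLabel_mul' (sec_mem genB_mem _), rootLabel_inv' (sec_mem genB_mem _),
      rootLabel_sec_add_two genB_mem, add_neg_cancel]
  · simp only [central, hsec, exponentB_mul (sec_mem genB_mem _)
      (inv_mem (sec_mem genB_mem _)), exponentB_inv (sec_mem genB_mem _)]
    decide

/-! ### Orders of the congruence quotients -/

theorem congruenceIndex_secondGrigorchuk_one : congruenceIndex secondGrigorchuk 1 = 4 :=
  congruenceIndex_one secondGrigorchuk_le_Gamma genA_mem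

/-- The recursion at level `n + 2`, where `m` generates the annihilator of the central coordinates
of the stabiliser of that level. -/
theorem congruenceIndex_secondGrigorchuk_succ (n : ℕ) (m : Fin 4)
    (h1 : ∀ f ∈ secondGrigorchuk, f ∈ levelStab (n + 2) → m * central f = 0)
    (h2 : ∀ t, m * t = 0 → ∃ f ∈ secondGrigorchuk, f ∈ levelStab (n + 2) ∧ central f = t) :
    4 * congruenceIndex secondGrigorchuk (n + 2) ^ 4 =
      4 ^ 4 * Nat.card (Set.range fun t : Fin 4 => m * t) *
        congruenceIndex secondGrigorchuk (n + 3) := by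
  have h := isBranching.sup_pi_eq ((levelStab (n + 2)).subgroupOf secondGrigorchuk) m
    (fun f hf => ⟨rootLabel_eq_zero hf, exponentB_eq_zero hf, h1 f f.2 hf⟩)
    (fun t ht => by
      obtain ⟨f, hf, hf', rfl⟩ := h2 t ht
      exact ⟨⟨f, hf⟩, hf', rfl⟩)
  set N := Subgroup.pi Set.univ fun _ : Fin 4 => (levelStab (n + 2)).subgroupOf secondGrigorchuk
    with hN
  have hnormal : N.Normal := by
    refine ⟨fun d hd e x _ => ?_⟩
    exact (inferInstance : ((levelStab (n + 2)).subgroupOf secondGrigorchuk).Normal).conj_mem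
      _ (hd x trivial) (e x)
  have hindex : congruenceIndex secondGrigorchuk (n + 2) ^ 4 = N.index := by
    rw [hN, Subgroup.index_pi]
    simp [congruenceIndex]
  have hle : N ≤ coords.relations m := h ▸ le_sup_right
  rw [congruenceIndex_succ isSelfSimilar_secondGrigorchuk secondGrigorchuk_le_Gamma genA_mem
    (n + 2), hindex, ← Subgroup.relIndex_mul_index hle, coords.index_relations, ← h,
    Subgroup.relIndex_sup_right]
  ring

theorem congruenceIndex_secondGrigorchuk_two : congruenceIndex secondGrigorchuk 2 = 64 := by
  rw [congruenceIndex_succ isSelfSimilar_secondGrigorchuk secondGrigorchuk_le_Gamma genA_mem]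
  set D := (sections isSelfSimilar_secondGrigorchuk).range with hD
  let φ : D →* Multiplicative (Fin 4 × Fin 4) :=
    { toFun := fun d => Multiplicative.ofAdd (coords.α (d.1 0), coords.α (d.1 1))
      map_one' := rfl
      map_mul' := fun d e => congrArg Multiplicative.ofAdd
        (Prod.ext (coords.α_mul _ _) (coords.α_mul _ _)) }
  have hφ : ∀ d, (φ d).toAdd = (coords.α (d.1 0), coords.α (d.1 1)) := fun _ => rfl
  have hker : (Subgroup.pi Set.univ fun _ : Fin 4 =>
      (levelStab 1).subgroupOf secondGrigorchuk).subgroupOf D = φ.ker := by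
    ext d
    obtain ⟨_, f, rfl⟩ := d
    have hs : ∀ x, sec f.1 x ∈ levelStab 1 ↔ rootLabel (sec f.1 x) = 0 := fun x =>
      mem_levelStab_one (sec_mem_Gamma (secondGrigorchuk_le_Gamma f.2.2) x)
    have h0 := rootLabel_sec_add_two f.2.2 0
    have h1 := rootLabel_sec_add_two f.2.2 1
    have hd : (⟨sections isSelfSimilar_secondGrigorchuk f, f, rfl⟩ : D) ∈ φ.ker ↔
        rootLabel (sec f.1 0) = 0 ∧ rootLabel (sec f.1 1) = 0 := Prod.ext_iff
    rw [hd, Subgroup.mem_subgroupOf, Subgroup.mem_pi]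
    constructor
    · exact fun h => ⟨(hs 0).1 (h 0 trivial), (hs 1).1 (h 1 trivial)⟩
    · rintro ⟨h, h'⟩ x -
      refine (hs x).2 ?_
      fin_cases x
      exacts [h, h', h0.trans h, h1.trans h']
  have hrange : φ.range = ⊤ := by
    rw [MonoidHom.range_eq_top]
    intro t
    refine ⟨⟨_, D.mul_mem (D.pow_mem isBranching.gen t.toAdd.1.val)
      (D.pow_mem (isBranching.rotate isBranching.gen 1) t.toAdd.2.val)⟩, ?_⟩
    apply Multiplicative.toAdd.injective
    rw [hφ]
    apply Prod.ext <;> simp [coords.α_pow, coords.α_a, -SubmonoidClass.mk_pow]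
  rw [Subgroup.relIndex, hker, Subgroup.index_ker, hrange, Subgroup.card_top]
  simp [Nat.card_eq_fintype_card]

theorem congruenceIndex_secondGrigorchuk_three :
    congruenceIndex secondGrigorchuk 3 = 2 ^ 17 := by
  have hcard : Nat.card (Set.range fun t : Fin 4 => 2 * t) = 2 := by
    rw [Nat.card_eq_fintype_card]
    decide
  have h := congruenceIndex_secondGrigorchuk_succ 0 2
    (fun f hf hf' => two_mul_central_eq_zero hf hf') (fun t ht => by
      have : t = 0 ∨ t = 2 := by
        revert t
        decide
      rcases this with rfl | rfl
      · exact ⟨1, one_mem _, one_mem _, rfl⟩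
      · exact exists_central_eq_two)
  rw [hcard, zero_add, zero_add, congruenceIndex_secondGrigorchuk_two] at h
  omega

theorem congruenceIndex_secondGrigorchuk_add_four (n : ℕ) :
    congruenceIndex secondGrigorchuk (n + 3) ^ 4 =
      4 ^ 4 * congruenceIndex secondGrigorchuk (n + 4) := by
  have hcard : Nat.card (Set.range fun t : Fin 4 => 1 * t) = 4 := by
    rw [Nat.card_eq_fintype_card]
    decide
  have h := congruenceIndex_secondGrigorchuk_succ (n + 1) 1
    (fun f _ hf' => by rw [central_eq_zero hf', mul_zero]) (fun t ht => by
      rw [one_mul] at ht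
      exact ⟨1, one_mem _, one_mem _, ht.symm⟩)
  rw [hcard] at h
  linarith

theorem logb_congruenceIndex_secondGrigorchuk (n : ℕ) :
    0 < congruenceIndex secondGrigorchuk (n + 3) ∧
      Real.logb 4 (congruenceIndex secondGrigorchuk (n + 3)) =
        (1 / 3) * (86 * (4 : ℝ) ^ ((n : ℤ) - 1) + 4) := by
  induction n with
  | zero =>
    rw [congruenceIndex_secondGrigorchuk_three]
    refine ⟨by norm_num, ?_⟩
    have h2 : Real.logb 4 2 = 1 / 2 := by
      rw [Real.logb_eq_iff_rpow_eq (by norm_num) (by norm_num) (by norm_num),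
        ← Real.sqrt_eq_rpow, show (4 : ℝ) = 2 ^ 2 by norm_num, Real.sqrt_sq (by norm_num)]
    rw [Nat.cast_pow, Nat.cast_ofNat, Real.logb_pow, h2]
    norm_num
  | succ n ih =>
    obtain ⟨hpos, ih⟩ := ih
    have h := congruenceIndex_secondGrigorchuk_add_four n
    have hpos' : 0 < congruenceIndex secondGrigorchuk (n + 4) := by
      refine Nat.pos_of_ne_zero fun h0 => ?_
      rw [h0, mul_zero] at h
      exact (pow_pos hpos 4).ne' h
    refine ⟨hpos', ?_⟩
    have hlog := congrArg (fun k : ℕ => Real.logb 4 k) h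
    simp only [Nat.cast_pow, Nat.cast_mul, Nat.cast_ofNat] at hlog
    rw [Real.logb_pow, Real.logb_mul (by norm_num) (by positivity), Real.logb_pow,
      Real.logb_self_eq_one (by norm_num), ih, zpow_sub₀ (by norm_num), zpow_natCast] at hlog
    have hz : (4 : ℝ) ^ (((n + 1 : ℕ) : ℤ) - 1) = 4 ^ n := by
      rw [Nat.cast_succ, add_sub_cancel_right, zpow_natCast]
    rw [show n + 1 + 3 = n + 4 from rfl, hz]
    norm_num at hlog ⊢
    linarith

theorem logb_congruenceIndex_Gamma (n : ℕ) :
    0 < congruenceIndex Gamma n ∧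
      Real.logb 4 (congruenceIndex Gamma n) = (1 / 3) * ((4 : ℝ) ^ n - 1) := by
  induction n with
  | zero => simp [congruenceIndex_zero]
  | succ n ih =>
    obtain ⟨hpos, ih⟩ := ih
    rw [congruenceIndex_Gamma_succ]
    refine ⟨by positivity, ?_⟩
    push_cast
    rw [Real.logb_mul (by norm_num) (by positivity), Real.logb_pow,
      Real.logb_self_eq_one (by norm_num), ih]
    push_cast
    ring

theorem hausdorffDim_topologicalClosure :
    hausdorffDim secondGrigorchuk.topologicalClosure = 43 / 128 := by
  refine Tendsto.liminf_eq ?_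
  rw [← tendsto_add_atTop_iff_nat 3]
  have hu : Tendsto (fun n : ℕ => (1 / 4 : ℝ) ^ n) atTop (𝓝 0) :=
    tendsto_pow_atTop_nhds_zero_of_lt_one (by norm_num) (by norm_num)
  have hlim : Tendsto (fun n : ℕ => (43 / 2 + 4 * (1 / 4 : ℝ) ^ n) / (64 - (1 / 4) ^ n)) atTop
      (𝓝 ((43 / 2 + 4 * 0) / (64 - 0))) :=
    ((hu.const_mul 4).const_add _).div (hu.const_sub _) (by norm_num)
  convert hlim using 2 with n
  · have h4 : Real.log 4 ≠ 0 := (Real.log_pos (by norm_num)).ne'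
    rw [congruenceIndex_topologicalClosure, ← div_div_div_cancel_right₀ h4]
    change Real.logb 4 _ / Real.logb 4 _ = _
    rw [(logb_congruenceIndex_secondGrigorchuk n).2, (logb_congruenceIndex_Gamma (n + 3)).2,
      zpow_sub₀ (by norm_num), zpow_natCast, one_div_pow, pow_add]
    have h1 : (1 : ℝ) ≤ 4 ^ n := one_le_pow₀ (by norm_num)
    have h2 : (4 : ℝ) ^ n * 4 ^ 3 - 1 ≠ 0 := by nlinarith
    have h3 : 64 - 1 / (4 : ℝ) ^ n ≠ 0 := by
      have : 1 / (4 : ℝ) ^ n ≤ 1 := by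
        rw [div_le_one (by positivity)]
        exact h1
      linarith
    rw [div_eq_div_iff (by simpa using h2) h3]
    field_simp
    ring
  · norm_num

end Grigorchuk

theorem theoremA :
    (Real.logb 4 (Grigorchuk.congruenceIndex Grigorchuk.secondGrigorchuk 1) = 1 ∧
      Real.logb 4 (Grigorchuk.congruenceIndex Grigorchuk.secondGrigorchuk 2) = 3 ∧
      ∀ n : ℕ, 2 < n →
        Real.logb 4 (Grigorchuk.congruenceIndex Grigorchuk.secondGrigorchuk n) =
          (1 / 3) * (86 * (4 : ℝ) ^ ((n : ℤ) - 4) + 4)) ∧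
    Grigorchuk.hausdorffDim Grigorchuk.secondGrigorchuk.topologicalClosure = 43 / 128 := by
  refine ⟨⟨?_, ?_, fun n hn => ?_⟩, Grigorchuk.hausdorffDim_topologicalClosure⟩
  · rw [Grigorchuk.congruenceIndex_secondGrigorchuk_one]
    norm_num
  · rw [Grigorchuk.congruenceIndex_secondGrigorchuk_two, show ((64 : ℕ) : ℝ) = 4 ^ 3 by norm_num,
      Real.logb_pow, Real.logb_self_eq_one (by norm_num)]
    norm_num
  · obtain ⟨k, rfl⟩ : ∃ k, n = k + 3 := ⟨n - 3, by omega⟩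
    rw [(Grigorchuk.logb_congruenceIndex_secondGrigorchuk k).2]
    congr 4
    push_cast
    ring
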